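/- Let $\Omega$ be a compact metric space and let $K:\Omega\times\Omega\to\mathbb R$ be a kernel, i.e. continuous and symmetric. Let $\mathcal M(\Omega)$ be the space of finite signed (regular) Borel measures on $\Omega$ and $\mathbb P(\Omega)$ the set of Borel probability measures. For $\nu_1,\nu_2\in\mathcal M(\Omega)$ put $$I_K(\nu_1,\nu_2)=\int_\Omega\int_\Omega K(x,y)\,d\nu_1(x)\,d\nu_2(y),\qquad I_K(\nu)=I_K(\nu,\nu).$$ Suppose that $\mu\in\mathbb P(\Omega)$ is $K$-invariant, i.e. $\int_\Omega K(x,y)\,d\mu(y)=I_K(\mu)$ for every $x\in\Omega$, and has full support, $\operatorname{supp}\mu=\Omega$. Let $T_{K,\mu}\psi(x)=\int_\Omega K(x,y)\psi(y)\,d\mu(y)$. Then the following conditions are equivalent. 1. $K$ is positive definite, i.e. $I_K(\nu)\ge 0$ for every $\nu\in\mathcal M(\Omega)$. 2. $I_K(\mu_1)\ge 0$ and $I_K(\mu_1,\mu_2)\le\sqrt{I_K(\mu_1)\,I_K(\mu_2)}$ for all $\mu_1,\mu_2\in\mathbb P(\Omega)$. 3. $I_K(\mu)\ge 0$ and $I_K(\mu)\le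 I_K(\nu)$ for all $\nu\in\mathbb P(\Omega)$. 4. $I_K$ is convex on $\mathcal M(\Omega)$. 5. There are real numbers $\lambda_j\ge 0$ and functions $\phi_j:\Omega\to\mathbb R$, $1\le j\le\dim L^2(\Omega,\mu)$ (all $j\ge 1$ if the dimension is infinite), such that for all $x,y\in\Omega$ $$K(x,y)=\sum_{j=1}^{\dim L^2(\Omega,\mu)}\lambda_j\,\phi_j(x)\,\phi_j(y),$$ where the series converges absolutely, and uniformly on $\Omega\times\Omega$. 6. The same as 5, where in addition the $\phi_j$ form an orthonormal basis of $L^2(\Omega,\mu)$ and are eigenfunctions of $T_{K,\mu}$ with eigenvalues $\lambda_j$, $T_{K,\mu}\phi_j=\lambda_j\phi_j$ at every point of $\Omega$. 7. There is a symmetric function $k\in L^2(\Omega\times\Omega,\mu\times\mu)$ such that for all $x,y\in\Omega$ the function $z\mapsto k(x,z)k(z,y)$ is $\mu$-integrable and $$K(x,y)=\int_\Omega k(x,z)\,k(z,y)\,d\mu(z).$$ -/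

import Mathlib

open MeasureTheory Filter Topology

noncomputable section

namespace KernelEnergy

variable {Ω : Type*}

/-- A kernel on `Ω × Ω`: a continuous symmetric real-valued function. -/
structure IsKernel [TopologicalSpace Ω] (K : Ω → Ω → ℝ) : Prop where
  continuous : Continuous (fun p : Ω × Ω => K p.1 p.2)
  symm : ∀ x y, K x y = K y x

section Energy

variable [MeasurableSpace Ω]

/-- The mixed energy `I_K(μ, ν) = ∫∫ K(x, y) dμ(x) dν(y)` of two finite signed measures.
(On a compact metric space every finite signed Borel measure is regular, so `SignedMeasure Ω`
is the space `M(Ω)`.) -/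
def mixedEnergy (K : Ω → Ω → ℝ) (μ ν : SignedMeasure Ω) : ℝ :=
  VectorMeasure.integral ν
    (fun y => VectorMeasure.integral μ (fun x => K x y) (ContinuousLinearMap.lsmul ℝ ℝ))
    (ContinuousLinearMap.lsmul ℝ ℝ)

/-- The energy `I_K(μ) = I_K(μ, μ)`. -/
def energy (K : Ω → Ω → ℝ) (μ : SignedMeasure Ω) : ℝ := mixedEnergy K μ μ

/-- A probability measure, seen as a signed measure. -/
def toSigned (μ : ProbabilityMeasure Ω) : SignedMeasure Ω := (μ : Measure Ω).toSignedMeasure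

/-- The potential `U_K^μ(x) = ∫ K(x, y) dμ(y)`. -/
def potential (K : Ω → Ω → ℝ) (μ : ProbabilityMeasure Ω) (x : Ω) : ℝ :=
  ∫ y, K x y ∂(μ : Measure Ω)

/-- `μ` is `K`-invariant: its potential is constant, equal to `I_K(μ)`, on all of `Ω`. -/
def IsInvariant (K : Ω → Ω → ℝ) (μ : ProbabilityMeasure Ω) : Prop :=
  ∀ x, potential K μ x = energy K (toSigned μ)

/-- `K` is positive definite: `I_K(ν) ≥ 0` for every finite signed Borel measure `ν`. -/
def IsPosDef (K : Ω → Ω → ℝ) : Prop := ∀ ν : SignedMeasure Ω, 0 ≤ energy K ν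

/-- All probability measures have nonnegative energy, and
`I_K(μ₁, μ₂) ≤ √(I_K(μ₁) I_K(μ₂))` for all probability measures `μ₁`, `μ₂`. -/
def GeometricMeanInequality (K : Ω → Ω → ℝ) : Prop :=
  (∀ μ₁ : ProbabilityMeasure Ω, 0 ≤ energy K (toSigned μ₁)) ∧
    ∀ μ₁ μ₂ : ProbabilityMeasure Ω, mixedEnergy K (toSigned μ₁) (toSigned μ₂) ≤
      Real.sqrt (energy K (toSigned μ₁) * energy K (toSigned μ₂))

/-- `μ` minimizes `I_K` over all Borel probability measures. -/
def IsGlobalMinimizer (K : Ω → Ω → ℝ) (μ : ProbabilityMeasure Ω) : Prop :=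
  ∀ ν : ProbabilityMeasure Ω, energy K (toSigned μ) ≤ energy K (toSigned ν)

/-- The index set `{j : 0 ≤ j < dim L²(Ω, μ)}`. The Hamel dimension `Module.rank` is used: it is
the Hilbert dimension when this is finite, and is infinite otherwise, when the set is all of `ℕ`. -/
def dimIndex (μ : ProbabilityMeasure Ω) : Set ℕ :=
  {j | (j : Cardinal) < Module.rank ℝ (Lp ℝ 2 (μ : Measure Ω))}

open Classical in
/-- `K(x, y) = ∑_{j < dim L²(Ω, μ)} lam_j φ_j(x) φ_j(y)` for all `x, y`, the series converging
absolutely (at each point) and uniformly (its partial sums, on `Ω × Ω`), with all `lam_j ≥ 0`. -/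
def HasNonnegExpansion (K : Ω → Ω → ℝ) (μ : ProbabilityMeasure Ω)
    (lam : ℕ → ℝ) (φ : ℕ → Ω → ℝ) : Prop :=
  (∀ j ∈ dimIndex μ, 0 ≤ lam j) ∧
  (∀ x y, Summable fun j : dimIndex μ => |lam j * φ j x * φ j y|) ∧
  TendstoUniformly
    (fun (N : ℕ) (p : Ω × Ω) =>
      ∑ j ∈ Finset.range N with j ∈ dimIndex μ, lam j * φ j p.1 * φ j p.2)
    (fun p : Ω × Ω => K p.1 p.2) atTop

/-- The integral operator `(T_{K,μ} ψ)(x) = ∫ K(x, y) ψ(y) dμ(y)`. -/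
def integralOperator (K : Ω → Ω → ℝ) (μ : ProbabilityMeasure Ω) (ψ : Ω → ℝ) (x : Ω) : ℝ :=
  ∫ y, K x y * ψ y ∂(μ : Measure Ω)

/-- The functions `φ_j`, `j < dim L²(Ω, μ)`, form an orthonormal (Hilbert) basis of `L²(Ω, μ)` and
are eigenfunctions, `T_{K,μ} φ_j = lam_j φ_j`. The eigenvalue equation is required at every point,
which singles out the continuous representative of `φ_j` when `lam_j ≠ 0`. -/
def IsEigenbasis (K : Ω → Ω → ℝ) (μ : ProbabilityMeasure Ω)
    (lam : ℕ → ℝ) (φ : ℕ → Ω → ℝ) : Prop :=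
  (∃ b : HilbertBasis (dimIndex μ) ℝ (Lp ℝ 2 (μ : Measure Ω)),
    ∀ j : dimIndex μ, ⇑(b j) =ᵐ[(μ : Measure Ω)] φ j) ∧
  ∀ j ∈ dimIndex μ, ∀ x, integralOperator K μ (φ j) x = lam j * φ j x

/-- `K` has a convolution square root: a symmetric `k ∈ L²(Ω × Ω, μ × μ)` such that for all
`x, y` the integral `∫ k(x, z) k(z, y) dμ(z)` exists and equals `K(x, y)`. -/
def HasConvolutionRoot (K : Ω → Ω → ℝ) (μ : ProbabilityMeasure Ω) : Prop :=
  ∃ k : Ω → Ω → ℝ, (∀ x y, k x y = k y x) ∧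
    MemLp (fun p : Ω × Ω => k p.1 p.2) 2 ((μ : Measure Ω).prod (μ : Measure Ω)) ∧
    ∀ x y, Integrable (fun z => k x z * k z y) (μ : Measure Ω) ∧
      K x y = ∫ z, k x z * k z y ∂(μ : Measure Ω)

end Energy

end KernelEnergy

end

/-! `energy K` is a quadratic form, so its nonnegativity is the same as its convexity and yields
Cauchy–Schwarz, condition 2. Invariance gives I_K(μ, ν) = I_K(μ) for every probability measure ν, so
condition 2 reads I_K(μ)² ≤ I_K(μ) I_K(ν), and μ is a minimizer.

The crux is the passage from a minimizer to spectral data. By invariance the constant 1 is an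
eigenfunction of T_{K,μ}, with eigenvalue I_K(μ) ≥ 0. A continuous eigenfunction φ of mean zero
perturbs μ to the probability measure (1 + φ/C) μ, whose energy differs from I_K(μ) by a positive
multiple of the eigenvalue; minimality makes the eigenvalue nonnegative
(`IsGlobalMinimizer.eigenvalue_nonneg`). Mercer's theorem (`EigenSystem.tendstoUniformly`) then
gives the expansion, at every point because μ has full support, and ∑ √λ_j φ_j(x) φ_j(y) gives the
convolution root.

Conversely, an expansion or a root exhibits ∑ c_a c_b K(a, b) as a limit of sums of squares or as
the integral of a square. Discretizing signed measures (`exists_tendsto_mixedEnergy`) carries this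
over to I_K(ν). -/

namespace KernelEnergy

variable {Ω : Type*}

/-! ### Integration against signed measures -/

section Integral

variable [MeasurableSpace Ω]

/-- Makes constants integrable for a signed measure, and dominated convergence available with
constant bounds. -/
instance isFiniteMeasure_variation (ν : SignedMeasure Ω) : IsFiniteMeasure ν.variation := by
  have h : ν.variation ≤ ν.toJordanDecomposition.posPart + ν.toJordanDecomposition.negPart := by
    conv_lhs => rw [← ν.toSignedMeasure_toJordanDecomposition]
    refine VectorMeasure.variation_sub_le.trans ?_
    simp
  exact isFiniteMeasure_of_le _ h

theorem integral_toSignedMeasure_lsmul (μ : Measure Ω) [IsFiniteMeasure μ] (f : Ω → ℝ) :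
    VectorMeasure.integral μ.toSignedMeasure f (ContinuousLinearMap.lsmul ℝ ℝ) = ∫ x, f x ∂μ := by
  -- The formula for `toSignedMeasure` uses the flipped pairing; multiplication on ℝ is commutative.
  have h : (ContinuousLinearMap.lsmul ℝ ℝ : ℝ →L[ℝ] ℝ →L[ℝ] ℝ) =
      (ContinuousLinearMap.lsmul ℝ ℝ : ℝ →L[ℝ] ℝ →L[ℝ] ℝ).flip := by
    ext; simp
  rw [h]
  exact VectorMeasure.integral_toSignedMeasure

theorem integral_comp_simpleFunc {β : Type*} (ν : SignedMeasure Ω) (s : SimpleFunc Ω β)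
    (g : β → ℝ) :
    VectorMeasure.integral ν (fun x => g (s x)) (ContinuousLinearMap.lsmul ℝ ℝ) =
      ∑ a ∈ s.range, g a * ν (s ⁻¹' {a}) := by
  classical
  have h1 : (fun x => g (s x)) =
      fun x => ∑ a ∈ s.range, (s ⁻¹' {a}).indicator (fun _ => g a) x := by
    funext x
    rw [Finset.sum_eq_single (s x)]
    · simp
    · intro b _ hb
      exact Set.indicator_of_notMem (by simpa using hb.symm) _
    · simp
  rw [h1, VectorMeasure.integral_finsetSum]
  · refine Finset.sum_congr rfl fun a _ => ?_
    rw [VectorMeasure.integral_indicator (s.measurableSet_preimage _)]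
    simp [VectorMeasure.restrict_apply, s.measurableSet_preimage]
  · intro a _
    exact (integrable_const _).indicator (s.measurableSet_preimage _)

theorem mixedEnergy_toSigned (K : Ω → Ω → ℝ) (μ ν : ProbabilityMeasure Ω) :
    mixedEnergy K (toSigned μ) (toSigned ν) = ∫ y, ∫ x, K x y ∂(μ : Measure Ω) ∂(ν : Measure Ω) := by
  simp only [mixedEnergy, toSigned, integral_toSignedMeasure_lsmul]

end Integral

/-! ### Finite quadratic forms, and minimality from condition 2 -/

/-- Every quadratic form `∑ cᵢ cⱼ K(xᵢ, xⱼ)` is nonnegative. -/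
def IsFinitelyPosDef (K : Ω → Ω → ℝ) : Prop :=
  ∀ (s : Finset Ω) (c : Ω → ℝ), 0 ≤ ∑ a ∈ s, ∑ b ∈ s, c a * c b * K a b

/-- For a truncated series the quadratic form is ∑ λ_j (∑ c_a φ_j(a))²; pointwise convergence
suffices for the limit. -/
theorem isFinitelyPosDef_of_hasNonnegExpansion [MeasurableSpace Ω] {K : Ω → Ω → ℝ}
    {μ : ProbabilityMeasure Ω} {lam : ℕ → ℝ} {φ : ℕ → Ω → ℝ}
    (h : HasNonnegExpansion K μ lam φ) : IsFinitelyPosDef K := by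
  classical
  obtain ⟨hlam, -, hunif⟩ := h
  intro s c
  have ht : Tendsto (fun N : ℕ => ∑ a ∈ s, ∑ b ∈ s, c a * c b *
      ∑ j ∈ Finset.range N with j ∈ dimIndex μ, lam j * φ j a * φ j b) atTop
      (𝓝 (∑ a ∈ s, ∑ b ∈ s, c a * c b * K a b)) := by
    refine tendsto_finsetSum _ fun a _ => tendsto_finsetSum _ fun b _ => ?_
    refine Tendsto.const_mul _ ?_
    convert hunif.tendsto_at (a, b) using 3
  refine ge_of_tendsto' ht fun N => ?_
  have : ∑ a ∈ s, ∑ b ∈ s, c a * c b *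
      ∑ j ∈ Finset.range N with j ∈ dimIndex μ, lam j * φ j a * φ j b =
      ∑ j ∈ Finset.range N with j ∈ dimIndex μ, lam j * (∑ a ∈ s, c a * φ j a) ^ 2 := by
    simp_rw [sq, Finset.sum_mul_sum, Finset.mul_sum]
    conv_rhs => rw [Finset.sum_comm]
    refine Finset.sum_congr rfl fun a _ => ?_
    rw [Finset.sum_comm]
    exact Finset.sum_congr rfl fun b _ => Finset.sum_congr rfl fun j _ => by ring
  rw [this]
  exact Finset.sum_nonneg fun j hj =>
    mul_nonneg (hlam j (Finset.mem_filter.1 hj).2) (sq_nonneg _)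

/-- The quadratic form equals ∫ (∑ c_a k(a, z))² dμ(z). -/
theorem isFinitelyPosDef_of_hasConvolutionRoot [MeasurableSpace Ω] {K : Ω → Ω → ℝ}
    {μ : ProbabilityMeasure Ω} (h : HasConvolutionRoot K μ) : IsFinitelyPosDef K := by
  obtain ⟨k, hsymm, -, hk⟩ := h
  intro s c
  have : ∑ a ∈ s, ∑ b ∈ s, c a * c b * K a b =
      ∫ z, (∑ a ∈ s, c a * k a z) ^ 2 ∂(μ : Measure Ω) := by
    have hz : ∀ z, (∑ a ∈ s, c a * k a z) ^ 2 =
        ∑ a ∈ s, ∑ b ∈ s, c a * c b * (k a z * k z b) := by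
      intro z
      rw [sq, Finset.sum_mul_sum]
      refine Finset.sum_congr rfl fun a _ => Finset.sum_congr rfl fun b _ => ?_
      rw [hsymm z b]; ring
    simp_rw [hz]
    rw [integral_finsetSum _ fun a _ => integrable_finsetSum _ fun b _ =>
      (hk a b).1.const_mul _]
    refine Finset.sum_congr rfl fun a _ => ?_
    rw [integral_finsetSum _ fun b _ => (hk a b).1.const_mul _]
    refine Finset.sum_congr rfl fun b _ => ?_
    rw [integral_const_mul, (hk a b).2]
  rw [this]
  exact integral_nonneg fun z => sq_nonneg _

theorem IsKernel.exists_bound [TopologicalSpace Ω] [CompactSpace Ω] {K : Ω → Ω → ℝ}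
    (hK : IsKernel K) : ∃ C, ∀ x y, |K x y| ≤ C := by
  obtain ⟨C, hC⟩ := (isCompact_univ.image hK.continuous).isBounded.exists_norm_le
  exact ⟨C, fun x y => hC _ ⟨(x, y), trivial, rfl⟩⟩

theorem GeometricMeanInequality.isGlobalMinimizer [TopologicalSpace Ω] [MeasurableSpace Ω]
    {K : Ω → Ω → ℝ} (h : GeometricMeanInequality K)
    (hK : IsKernel K) {μ : ProbabilityMeasure Ω} (hinv : IsInvariant K μ) :
    IsGlobalMinimizer K μ ∧ 0 ≤ energy K (toSigned μ) := by
  refine ⟨fun ν => ?_, h.1 μ⟩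
  have h1 : mixedEnergy K (toSigned μ) (toSigned ν) = energy K (toSigned μ) := by
    rw [mixedEnergy_toSigned]
    have : ∀ y, ∫ x, K x y ∂(μ : Measure Ω) = energy K (toSigned μ) := fun y => by
      rw [← hinv y]
      simp only [potential, hK.symm y]
    simp [this]
  have h2 := h.2 μ ν
  rw [h1] at h2
  -- The squared inequality can be divided by I_K(μ) only when this is positive; at zero, minimality
  -- is the first half of condition 2.
  rcases (h.1 μ).eq_or_lt with h0 | h0
  · rw [← h0]; exact h.1 ν
  · have h3 := (Real.le_sqrt' h0).1 h2
    rw [sq] at h3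
    exact le_of_mul_le_mul_left h3 h0

/-! ### The energy as a quadratic form on signed measures -/

section Energy

variable [MetricSpace Ω] [CompactSpace Ω] [MeasurableSpace Ω] [BorelSpace Ω] {K : Ω → Ω → ℝ}

/-- The mixed energy of two signed measures is the limit of their mixed energies after
discretization along a sequence of simple functions converging to the identity. -/
theorem exists_tendsto_mixedEnergy (Ω : Type*) [MetricSpace Ω] [CompactSpace Ω]
    [MeasurableSpace Ω] [BorelSpace Ω] [Nonempty Ω] :
    ∃ s : ℕ → SimpleFunc Ω Ω, ∀ (K : Ω → Ω → ℝ), IsKernel K → ∀ μ ν : SignedMeasure Ω,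
      Tendsto (fun n => ∑ b ∈ (s n).range, ∑ a ∈ (s n).range,
        K a b * μ (s n ⁻¹' {a}) * ν (s n ⁻¹' {b})) atTop (𝓝 (mixedEnergy K μ ν)) := by
  -- One sequence serves all kernels and measures, so identities between the finite sums pass to the
  -- limit. Dominated convergence is applied in both integrals.
  refine ⟨fun n => SimpleFunc.nearestPt (TopologicalSpace.denseSeq Ω) n, fun K hK μ ν => ?_⟩
  set s : ℕ → SimpleFunc Ω Ω := fun n => SimpleFunc.nearestPt (TopologicalSpace.denseSeq Ω) n
  have hs : ∀ x, Tendsto (fun n => s n x) atTop (𝓝 x) := fun x =>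
    SimpleFunc.tendsto_nearestPt ((TopologicalSpace.denseRange_denseSeq Ω).closure_range ▸ trivial)
  obtain ⟨C, hC⟩ := hK.exists_bound
  have hmeas : ∀ (n : ℕ) (g : Ω → ℝ) (ρ : Measure Ω),
      AEStronglyMeasurable (fun x => g (s n x)) ρ := fun n g ρ =>
    ((s n).map g).aestronglyMeasurable
  have key : Tendsto (fun n => VectorMeasure.integral ν
      (fun y => VectorMeasure.integral μ (fun x => K (s n x) (s n y))
        (ContinuousLinearMap.lsmul ℝ ℝ)) (ContinuousLinearMap.lsmul ℝ ℝ)) atTop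
      (𝓝 (mixedEnergy K μ ν)) := by
    refine VectorMeasure.tendsto_integral_filter_of_norm_le_const
      (Eventually.of_forall fun n => hmeas n (fun b => VectorMeasure.integral μ
        (fun x => K (s n x) b) (ContinuousLinearMap.lsmul ℝ ℝ)) _)
      ⟨C * ‖(ContinuousLinearMap.lsmul ℝ ℝ : ℝ →L[ℝ] ℝ →L[ℝ] ℝ)‖ * μ.variation.real Set.univ,
        Eventually.of_forall fun n => Eventually.of_forall fun y => ?_⟩
      (Eventually.of_forall fun y => ?_)
    · exact VectorMeasure.norm_integral_le_of_norm_le_const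
        (Eventually.of_forall fun x => hC _ _)
    · refine VectorMeasure.tendsto_integral_filter_of_norm_le_const
        (Eventually.of_forall fun n => hmeas n (fun x => K x (s n y)) _)
        ⟨C, Eventually.of_forall fun n => Eventually.of_forall fun x => hC _ _⟩
        (Eventually.of_forall fun x => ?_)
      exact (hK.continuous.tendsto (x, y)).comp ((hs x).prodMk_nhds (hs y))
  refine key.congr fun n => ?_
  have h1 : ∀ b, VectorMeasure.integral μ (fun x => K (s n x) b)
      (ContinuousLinearMap.lsmul ℝ ℝ) = ∑ a ∈ (s n).range, K a b * μ (s n ⁻¹' {a}) :=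
    fun b => integral_comp_simpleFunc μ (s n) fun a => K a b
  simp_rw [h1]
  rw [integral_comp_simpleFunc ν (s n) fun b => ∑ a ∈ (s n).range, K a b * μ (s n ⁻¹' {a})]
  simp_rw [Finset.sum_mul]

/-- Each discretized energy is a finite quadratic form, with the masses of the cells as
coefficients. -/
theorem IsFinitelyPosDef.isPosDef [Nonempty Ω] (h : IsFinitelyPosDef K) (hK : IsKernel K) :
    IsPosDef K := by
  obtain ⟨s, hs⟩ := exists_tendsto_mixedEnergy Ω
  intro ν
  refine ge_of_tendsto' (hs K hK ν ν) fun n => ?_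
  rw [Finset.sum_comm]
  refine (h (s n).range fun a => ν (s n ⁻¹' {a})).trans_eq ?_
  exact Finset.sum_congr rfl fun a _ => Finset.sum_congr rfl fun b _ => by ring

theorem mixedEnergy_comm [Nonempty Ω] (hK : IsKernel K) (μ ν : SignedMeasure Ω) :
    mixedEnergy K μ ν = mixedEnergy K ν μ := by
  obtain ⟨s, hs⟩ := exists_tendsto_mixedEnergy Ω
  refine tendsto_nhds_unique (hs K hK μ ν) ((hs K hK ν μ).congr fun n => ?_)
  rw [Finset.sum_comm]
  refine Finset.sum_congr rfl fun a _ => Finset.sum_congr rfl fun b _ => ?_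
  rw [hK.symm b a]; ring

theorem mixedEnergy_smul_add_smul [Nonempty Ω] (hK : IsKernel K) (s t : ℝ)
    (μ₁ μ₂ ν : SignedMeasure Ω) :
    mixedEnergy K (s • μ₁ + t • μ₂) ν = s * mixedEnergy K μ₁ ν + t * mixedEnergy K μ₂ ν := by
  obtain ⟨σ, hσ⟩ := exists_tendsto_mixedEnergy Ω
  refine tendsto_nhds_unique (hσ K hK _ ν)
    ((((hσ K hK μ₁ ν).const_mul s).add ((hσ K hK μ₂ ν).const_mul t)).congr fun n => ?_)
  simp_rw [Finset.mul_sum, ← Finset.sum_add_distrib]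
  refine Finset.sum_congr rfl fun b _ => Finset.sum_congr rfl fun a _ => ?_
  simp only [add_apply, smul_apply, smul_eq_mul]
  ring

theorem energy_smul_add_smul [Nonempty Ω] (hK : IsKernel K) (s t : ℝ) (μ ν : SignedMeasure Ω) :
    energy K (s • μ + t • ν) =
      s ^ 2 * energy K μ + 2 * s * t * mixedEnergy K μ ν + t ^ 2 * energy K ν := by
  unfold energy
  rw [mixedEnergy_smul_add_smul hK, mixedEnergy_comm hK μ, mixedEnergy_comm hK ν (_ + _),
    mixedEnergy_smul_add_smul hK, mixedEnergy_smul_add_smul hK, mixedEnergy_comm hK ν μ]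
  ring

/-- For a + b = 1 the convexity defect a I(μ) + b I(ν) − I(aμ + bν) is ab I(μ − ν). -/
theorem IsPosDef.convexOn_energy [Nonempty Ω] (h : IsPosDef K) (hK : IsKernel K) :
    ConvexOn ℝ Set.univ (energy K : SignedMeasure Ω → ℝ) := by
  refine ⟨convex_univ, fun μ _ ν _ a b ha hb hab => ?_⟩
  have h1 := h ((1 : ℝ) • μ + (-1 : ℝ) • ν)
  rw [energy_smul_add_smul hK] at h1 ⊢
  obtain rfl : b = 1 - a := by linarith
  have h2 := mul_nonneg (mul_nonneg ha hb) h1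
  simp only [smul_eq_mul]
  nlinarith

/-- Midpoint convexity between ν and −ν gives 0 = I(0) ≤ I(ν). -/
theorem isPosDef_of_convexOn_energy [Nonempty Ω] (hK : IsKernel K)
    (h : ConvexOn ℝ Set.univ (energy K : SignedMeasure Ω → ℝ)) : IsPosDef K := by
  intro ν
  have h0 := h.2 (Set.mem_univ ν) (Set.mem_univ (-ν)) (show (0 : ℝ) ≤ 1 / 2 by norm_num)
    (show (0 : ℝ) ≤ 1 / 2 by norm_num) (by norm_num)
  have h1 := energy_smul_add_smul hK 0 (-1) ν ν
  have h2 := energy_smul_add_smul hK 0 0 ν ν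
  have e1 : (0 : ℝ) • ν + (-1 : ℝ) • ν = -ν := by
    ext i _
    simp
  have e2 : (0 : ℝ) • ν + (0 : ℝ) • ν = 0 := by simp
  have e3 : (1 / 2 : ℝ) • ν + (1 / 2 : ℝ) • (-ν) = 0 := by simp
  rw [e1] at h1
  rw [e2] at h2
  rw [e3, h1, h2] at h0
  simp only [smul_eq_mul] at h0
  linarith

theorem IsPosDef.geometricMeanInequality [Nonempty Ω] (h : IsPosDef K) (hK : IsKernel K) :
    GeometricMeanInequality K := by
  refine ⟨fun μ => h _, fun μ ν => Real.le_sqrt_of_sq_le ?_⟩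
  have hd : discrim (energy K (toSigned μ)) (2 * mixedEnergy K (toSigned μ) (toSigned ν))
      (energy K (toSigned ν)) ≤ 0 := by
    refine discrim_le_zero fun t => ?_
    have := h (t • toSigned μ + (1 : ℝ) • toSigned ν)
    rw [energy_smul_add_smul hK] at this
    linarith
  unfold discrim at hd
  linarith

end Energy

end KernelEnergy

/-! ### Perturbing the minimizer along an eigenfunction -/

namespace KernelEnergy

variable {Ω : Type*} [MetricSpace Ω] [CompactSpace Ω] [MeasurableSpace Ω] [BorelSpace Ω]
  {K : Ω → Ω → ℝ} {μ : ProbabilityMeasure Ω}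

theorem integrable_of_continuous {X : Type*} [TopologicalSpace X] [CompactSpace X]
    [MeasurableSpace X] [OpensMeasurableSpace X] {ν : Measure X} [IsFiniteMeasure ν]
    {f : X → ℝ} (hf : Continuous f) : Integrable f ν := by
  obtain ⟨C, hC⟩ := (isCompact_range hf).isBounded.exists_norm_le
  exact Integrable.of_bound hf.measurable.aestronglyMeasurable C
    (Eventually.of_forall fun x => hC _ ⟨x, rfl⟩)

/-- T_{K,μ} is symmetric and maps 1 to the constant I_K(μ). Hence an eigenfunction has mean zero or
eigenvalue I_K(μ). -/
theorem IsInvariant.mul_integral_eq (hinv : IsInvariant K μ) (hK : IsKernel K) {lam : ℝ}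
    {φ : Ω → ℝ} (hφ : Continuous φ) (heig : ∀ x, integralOperator K μ φ x = lam * φ x) :
    lam * ∫ x, φ x ∂(μ : Measure Ω) = energy K (toSigned μ) * ∫ x, φ x ∂(μ : Measure Ω) := by
  have hint : Integrable (fun p : Ω × Ω => K p.1 p.2 * φ p.2)
      ((μ : Measure Ω).prod (μ : Measure Ω)) :=
    integrable_of_continuous (hK.continuous.mul (hφ.comp continuous_snd))
  calc lam * ∫ x, φ x ∂(μ : Measure Ω)
      = ∫ x, ∫ y, K x y * φ y ∂(μ : Measure Ω) ∂(μ : Measure Ω) := by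
        rw [← integral_const_mul]
        exact integral_congr_ae (Eventually.of_forall fun x => (heig x).symm)
    _ = ∫ y, ∫ x, K x y * φ y ∂(μ : Measure Ω) ∂(μ : Measure Ω) := integral_integral_swap hint
    _ = ∫ y, energy K (toSigned μ) * φ y ∂(μ : Measure Ω) := by
        refine integral_congr_ae (Eventually.of_forall fun y => ?_)
        simp only [integral_mul_const]
        rw [← hinv y]
        simp only [potential, hK.symm y]
    _ = _ := integral_const_mul _ _

/-- If an invariant measure of nonnegative energy is a minimizer, then the eigenvalues of the
integral operator are nonnegative. -/
theorem IsGlobalMinimizer.eigenvalue_nonneg (hmin : IsGlobalMinimizer K μ)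
    (h0 : 0 ≤ energy K (toSigned μ)) (hinv : IsInvariant K μ) (hK : IsKernel K) {lam : ℝ}
    {φ : Ω → ℝ} (hφ : Continuous φ) (heig : ∀ x, integralOperator K μ φ x = lam * φ x)
    (hnorm : ∫ x, φ x ^ 2 ∂(μ : Measure Ω) = 1) : 0 ≤ lam := by
  have hm := hinv.mul_integral_eq hK hφ heig
  by_cases hz : ∫ x, φ x ∂(μ : Measure Ω) = 0
  swap
  · rw [mul_right_cancel₀ hz hm]; exact h0
  obtain ⟨C, hCpos, hC⟩ : ∃ C > 0, ∀ x, |φ x| ≤ C := by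
    obtain ⟨C, hC0, hC⟩ := (isCompact_range hφ).isBounded.exists_pos_norm_le
    exact ⟨C, hC0, fun x => hC _ ⟨x, rfl⟩⟩
  -- With |φ| ≤ C this density is nonnegative, and it has total mass 1 because φ has mean zero.
  set h : Ω → ℝ := fun x => 1 + C⁻¹ * φ x with hh
  have hcont : Continuous h := by fun_prop
  have hnn : ∀ x, 0 ≤ h x := fun x => by
    have h1 : C⁻¹ * (-C) ≤ C⁻¹ * φ x :=
      mul_le_mul_of_nonneg_left (abs_le.1 (hC x)).1 (by positivity)
    have h2 : C⁻¹ * (-C) = -1 := by field_simp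
    simp only [hh]; linarith
  have hφi : Integrable φ (μ : Measure Ω) := integrable_of_continuous hφ
  have hone : ∫ x, h x ∂(μ : Measure Ω) = 1 := by
    simp only [hh]
    rw [integral_add (integrable_const _) (hφi.const_mul _), integral_const_mul, hz]
    simp
  let ν' : Measure Ω := (μ : Measure Ω).withDensity fun x => ENNReal.ofReal (h x)
  have hprob : IsProbabilityMeasure ν' := ⟨by
    rw [withDensity_apply _ MeasurableSet.univ, Measure.restrict_univ,
      ← ofReal_integral_eq_lintegral_ofReal (integrable_of_continuous hcont)
        (Eventually.of_forall hnn), hone, ENNReal.ofReal_one]⟩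
  have hintν : ∀ g : Ω → ℝ, ∫ x, g x ∂ν' = ∫ x, h x * g x ∂(μ : Measure Ω) := fun g => by
    refine (integral_withDensity_eq_integral_toReal_smul
      (ENNReal.measurable_ofReal.comp hcont.measurable)
      (Eventually.of_forall fun x => ENNReal.ofReal_lt_top) g).trans ?_
    refine integral_congr_ae (Eventually.of_forall fun x => ?_)
    simp [ENNReal.toReal_ofReal (hnn x)]
  let ν : ProbabilityMeasure Ω := ⟨ν', hprob⟩
  have hmin' := hmin ν
  -- Invariance and the mean-zero condition kill the terms linear in φ; the quadratic term is λ C⁻²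
  -- ∫ φ² = λ C⁻².
  have hE : energy K (toSigned ν) = energy K (toSigned μ) + lam * C⁻¹ ^ 2 := by
    rw [energy, mixedEnergy_toSigned]
    change ∫ y, ∫ x, K x y ∂ν' ∂ν' = _
    simp only [hintν]
    have hin : ∀ y, ∫ x, h x * K x y ∂(μ : Measure Ω) =
        energy K (toSigned μ) + C⁻¹ * (lam * φ y) := fun y => by
      have hKc : Continuous (K y) := hK.continuous.comp (by fun_prop : Continuous fun x => (y, x))
      have hi : Integrable (fun x => C⁻¹ * (K y x * φ x)) (μ : Measure Ω) :=
        (integrable_of_continuous (hKc.mul hφ)).const_mul _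
      rw [← hinv y, ← heig y, potential, integralOperator, ← integral_const_mul,
        ← integral_add (integrable_of_continuous hKc) hi]
      refine integral_congr_ae (Eventually.of_forall fun x => ?_)
      simp only [hh, hK.symm x y]; ring
    simp_rw [hin]
    have : ∀ y, h y * (energy K (toSigned μ) + C⁻¹ * (lam * φ y)) =
        energy K (toSigned μ) * h y + (lam * C⁻¹ * φ y + lam * C⁻¹ ^ 2 * φ y ^ 2) := fun y => by
      simp only [hh]; ring
    simp_rw [this]
    have hi2 : Integrable (fun y => lam * C⁻¹ ^ 2 * φ y ^ 2) (μ : Measure Ω) :=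
      (integrable_of_continuous (hφ.pow 2)).const_mul _
    have hi3 : Integrable (fun y => lam * C⁻¹ * φ y + lam * C⁻¹ ^ 2 * φ y ^ 2) (μ : Measure Ω) :=
      (hφi.const_mul _).add hi2
    rw [integral_add ((integrable_of_continuous hcont).const_mul _) hi3, integral_add (hφi.const_mul _) hi2, integral_const_mul,
      integral_const_mul, integral_const_mul, hone, hz, hnorm]
    ring
  rw [hE] at hmin'
  have : 0 ≤ lam * C⁻¹ ^ 2 := by linarith
  exact nonneg_of_mul_nonneg_left this (by positivity)

end KernelEnergy

/-! ### Hilbert bases of eigenvectors and their index sets -/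

namespace KernelEnergy

universe u

/-- A compact symmetric operator on a Hilbert space has a Hilbert basis of eigenvectors. -/
theorem exists_hilbertBasis_eigenvectors {E : Type u} [NormedAddCommGroup E]
    [InnerProductSpace ℝ E] [CompleteSpace E] {T : E →L[ℝ] E} (hT : IsCompactOperator T)
    (hT' : (T : E →ₗ[ℝ] E).IsSymmetric) :
    ∃ (ι : Type u) (b : HilbertBasis ι ℝ E) (l : ι → ℝ), ∀ i, T (b i) = l i • b i := by
  let V : ℝ → Submodule ℝ E := fun l => Module.End.eigenspace (T : E →ₗ[ℝ] E) l
  have hV : OrthogonalFamily ℝ (fun l => V l) fun l => (V l).subtypeₗᵢ :=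
    hT'.orthogonalFamily_eigenspaces
  have hcl : ∀ l, IsClosed (V l : Set E) := fun l => by
    have : (V l : Set E) = {x | T x = l • x} := by
      ext x; exact Module.End.mem_eigenspace_iff
    rw [this]
    exact isClosed_eq T.continuous (continuous_const_smul l)
  have : ∀ l, CompleteSpace (V l) := fun l => (hcl l).completeSpace_coe
  choose w b hb using fun l => exists_hilbertBasis ℝ (V l)
  have hon := hV.orthonormal_sigma_orthonormal fun l => (b l).orthonormal
  -- A vector orthogonal to the bases of all eigenspaces, the kernel included, is orthogonal to each
  -- eigenspace, so it vanishes by the spectral theorem.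
  have hbot : (Submodule.span ℝ (Set.range fun a : Σ l, w l =>
      (V a.1).subtypeₗᵢ (b a.1 a.2)))ᗮ = ⊥ := by
    rw [eq_bot_iff, ← ContinuousLinearMap.orthogonalComplement_iSup_eigenspaces_eq_bot hT hT']
    intro x hx
    rw [Submodule.mem_orthogonal'] at hx
    rw [← Submodule.iInf_orthogonal, Submodule.mem_iInf]
    intro l
    rw [Submodule.mem_orthogonal']
    intro y hy
    have h1 := (((b l).hasSum_repr ⟨y, hy⟩).mapL (V l).subtypeL).mapL (innerSL ℝ x)
    have h2 : ∀ i, innerSL ℝ x ((V l).subtypeL ((b l).repr ⟨y, hy⟩ i • b l i)) = 0 := fun i => by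
      rw [map_smul, map_smul]
      have : innerSL ℝ x ((V l).subtypeL (b l i)) = 0 :=
        hx _ (Submodule.subset_span ⟨⟨l, i⟩, rfl⟩)
      rw [this, smul_zero]
    simp_rw [h2] at h1
    exact h1.unique hasSum_zero
  refine ⟨Σ l, w l, HilbertBasis.mkOfOrthogonalEqBot hon hbot, fun a => a.1, fun a => ?_⟩
  rw [HilbertBasis.coe_mkOfOrthogonalEqBot]
  exact Module.End.mem_eigenspace_iff.1 (b a.1 a.2).2

/-- Orthonormal vectors lie at distance √2 > 1, so the balls of radius 1/2 around them are disjoint.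
-/
theorem countable_of_hilbertBasis {ι E : Type*} [NormedAddCommGroup E]
    [InnerProductSpace ℝ E] [TopologicalSpace.SeparableSpace E] (b : HilbertBasis ι ℝ E) :
    Countable ι := by
  refine Pairwise.countable_of_isOpen_disjoint (s := fun i => Metric.ball (b i) (1 / 2))
    (fun i j hij => Metric.ball_disjoint_ball ?_) (fun i => Metric.isOpen_ball)
    (fun i => Metric.nonempty_ball.2 (by norm_num))
  have h1 : ‖b i - b j‖ ^ 2 = 2 := by
    rw [norm_sub_sq_real, b.orthonormal.1 i, b.orthonormal.1 j, b.orthonormal.2 hij]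
    norm_num
  rw [dist_eq_norm]
  nlinarith [norm_nonneg (b i - b j)]

/-- The index type of a Hilbert basis of `L²(Ω, μ)` is in bijection with `dimIndex μ` as soon as
it is countable. -/
theorem nonempty_equiv_dimIndex {Ω : Type*} [MeasurableSpace Ω] {μ : ProbabilityMeasure Ω}
    {ι : Type*} [Countable ι] (b : HilbertBasis ι ℝ (Lp ℝ 2 (μ : Measure Ω))) :
    Nonempty (dimIndex μ ≃ ι) := by
  cases finite_or_infinite ι with
  | inl h =>
    have := Fintype.ofFinite ι
    have hr : Module.rank ℝ (Lp ℝ 2 (μ : Measure Ω)) = Fintype.card ι :=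
      rank_eq_card_basis b.toOrthonormalBasis.toBasis
    have : dimIndex μ = {j | j < Fintype.card ι} := by
      ext j; simp [dimIndex, hr]
    rw [this]
    exact ⟨Fin.equivSubtype.symm.trans (Fintype.equivFin ι).symm⟩
  | inr h =>
    have hr : Cardinal.aleph0 ≤ Module.rank ℝ (Lp ℝ 2 (μ : Measure Ω)) := by
      have h1 := b.orthonormal.linearIndependent.cardinal_lift_le_rank
      have h2 : Cardinal.aleph0 ≤ Cardinal.lift (Cardinal.mk ι) :=
        Cardinal.aleph0_le_lift.2 (Cardinal.aleph0_le_mk ι)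
      simpa using h2.trans h1
    have : dimIndex μ = Set.univ := by
      ext j
      simpa [dimIndex] using (Cardinal.natCast_lt_aleph0 (n := j)).trans_le hr
    rw [this]
    obtain ⟨e⟩ := nonempty_equiv_of_countable (α := ℕ) (β := ι)
    exact ⟨(Equiv.Set.univ ℕ).trans e⟩

theorem exists_reindex {ι κ E : Type*} [NormedAddCommGroup E] [InnerProductSpace ℝ E]
    [CompleteSpace E] (b : HilbertBasis ι ℝ E) (e : κ ≃ ι) :
    ∃ b' : HilbertBasis κ ℝ E, ∀ k, b' k = b (e k) := by
  have hon := b.orthonormal.comp e e.injective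
  refine ⟨HilbertBasis.mk hon ?_, fun k => by rw [HilbertBasis.coe_mk]; rfl⟩
  rw [Set.range_comp, e.surjective.range_eq, Set.image_univ, b.dense_span]

end KernelEnergy

/-! ### The integral operator: compactness and symmetry -/

namespace KernelEnergy

variable {Ω : Type*} [MetricSpace Ω] [CompactSpace Ω] {K : Ω → Ω → ℝ}

/-- The continuous map `x ↦ K(x, ·)` into `C(Ω, ℝ)`. -/
def IsKernel.toCurry (hK : IsKernel K) : C(Ω, C(Ω, ℝ)) :=
  ContinuousMap.curry ⟨fun p : Ω × Ω => K p.1 p.2, hK.continuous⟩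

variable [MeasurableSpace Ω] [BorelSpace Ω]

/-- The section `K(x, ·)` as an element of `L²(Ω, μ)`, depending continuously on `x`. -/
noncomputable def IsKernel.sectionLp (hK : IsKernel K) (μ : ProbabilityMeasure Ω) :
    C(Ω, Lp ℝ 2 (μ : Measure Ω)) :=
  ⟨fun x => ContinuousMap.toLp 2 (μ : Measure Ω) ℝ (hK.toCurry x),
    (ContinuousMap.toLp 2 (μ : Measure Ω) ℝ).continuous.comp hK.toCurry.continuous⟩

variable {μ : ProbabilityMeasure Ω}

theorem IsKernel.coeFn_sectionLp (hK : IsKernel K) (x : Ω) :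
    hK.sectionLp μ x =ᵐ[(μ : Measure Ω)] K x :=
  ContinuousMap.coeFn_toLp (𝕜 := ℝ) (p := 2) (μ : Measure Ω) (hK.toCurry x)

/-- The value of T_{K,μ} φ at each single point depends only on the class of φ, which is what allows
eigenvalue equations to hold everywhere. -/
theorem IsKernel.inner_sectionLp (hK : IsKernel K) (x : Ω) (f : Lp ℝ 2 (μ : Measure Ω))
    {φ : Ω → ℝ} (hφ : f =ᵐ[(μ : Measure Ω)] φ) :
    inner ℝ (hK.sectionLp μ x) f = integralOperator K μ φ x := by
  rw [L2.inner_def, integralOperator]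
  refine integral_congr_ae ?_
  filter_upwards [hK.coeFn_sectionLp (μ := μ) x, hφ] with y h1 h2
  rw [h1, h2, real_inner_comm]
  rfl

/-- The integral operator with kernel `K`, from `L²(Ω, μ)` to `C(Ω, ℝ)`. -/
noncomputable def IsKernel.operatorToC (hK : IsKernel K) (μ : ProbabilityMeasure Ω) :
    Lp ℝ 2 (μ : Measure Ω) →L[ℝ] C(Ω, ℝ) :=
  LinearMap.mkContinuous
    { toFun := fun f => ⟨fun x => inner ℝ (hK.sectionLp μ x) f, by fun_prop⟩
      map_add' := fun f g => by ext x; exact inner_add_right (𝕜 := ℝ) (hK.sectionLp μ x) f g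
      map_smul' := fun c f => by ext x; exact real_inner_smul_right (hK.sectionLp μ x) f c }
    ‖hK.sectionLp μ‖ fun f => by
      refine (ContinuousMap.norm_le _ (by positivity)).2 fun x => ?_
      refine (norm_inner_le_norm (𝕜 := ℝ) (hK.sectionLp μ x) f).trans ?_
      exact mul_le_mul_of_nonneg_right ((hK.sectionLp μ).norm_coe_le_norm x) (norm_nonneg _)

theorem IsKernel.operatorToC_apply (hK : IsKernel K) (f : Lp ℝ 2 (μ : Measure Ω)) (x : Ω) :
    hK.operatorToC μ f x = inner ℝ (hK.sectionLp μ x) f := rfl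

/-- Arzelà–Ascoli: the image of the unit ball is bounded, and equicontinuous because x ↦ K(x, ·) is
continuous into L². -/
theorem IsKernel.isCompactOperator_operatorToC (hK : IsKernel K) :
    IsCompactOperator (hK.operatorToC μ) := by
  let e := ContinuousMap.linearIsometryBoundedOfCompact Ω ℝ ℝ
  have hA : IsCompact (closure ((fun f => e (hK.operatorToC μ f)) '' Metric.closedBall 0 1)) := by
    refine BoundedContinuousFunction.arzela_ascoli
      (Metric.closedBall 0 ‖hK.operatorToC μ‖) (isCompact_closedBall _ _) _ ?_ ?_
    · rintro _ x ⟨f, hf, rfl⟩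
      rw [mem_closedBall_zero_iff] at hf ⊢
      exact ((hK.operatorToC μ f).norm_coe_le_norm x).trans
        (((hK.operatorToC μ).le_opNorm f).trans (mul_le_of_le_one_right (norm_nonneg _) hf))
    · intro x₀
      rw [Metric.equicontinuousAt_iff]
      intro ε hε
      obtain ⟨δ, hδ, h⟩ := Metric.continuous_iff.1 (hK.sectionLp μ).continuous x₀ ε hε
      refine ⟨δ, hδ, fun x hx => ?_⟩
      rintro ⟨_, f, hf, rfl⟩
      rw [mem_closedBall_zero_iff] at hf
      change dist (inner ℝ (hK.sectionLp μ x₀) f) (inner ℝ (hK.sectionLp μ x) f) < ε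
      rw [dist_comm, dist_eq_norm, ← inner_sub_left]
      refine ((norm_inner_le_norm _ _).trans (mul_le_of_le_one_right (norm_nonneg _) hf)).trans_lt ?_
      rw [← dist_eq_norm]
      exact h x hx
  have hc : IsCompactOperator (fun f => e (hK.operatorToC μ f)) :=
    (isCompactOperator_iff_exists_mem_nhds_isCompact_closure_image _).2
      ⟨_, Metric.closedBall_mem_nhds 0 one_pos, hA⟩
  have h := hc.continuous_comp e.symm.continuous
  have he : e.symm ∘ (fun f => e (hK.operatorToC μ f)) = hK.operatorToC μ := by
    funext f
    simp
  rwa [he] at h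

/-- The integral operator with kernel `K` on `L²(Ω, μ)`. -/
noncomputable def IsKernel.operator (hK : IsKernel K) (μ : ProbabilityMeasure Ω) :
    Lp ℝ 2 (μ : Measure Ω) →L[ℝ] Lp ℝ 2 (μ : Measure Ω) :=
  (ContinuousMap.toLp 2 (μ : Measure Ω) ℝ).comp (hK.operatorToC μ)

theorem IsKernel.isCompactOperator_operator (hK : IsKernel K) :
    IsCompactOperator (hK.operator μ) :=
  hK.isCompactOperator_operatorToC.continuous_comp
    (ContinuousMap.toLp 2 (μ : Measure Ω) ℝ).continuous

theorem IsKernel.coeFn_operator (hK : IsKernel K) (f : Lp ℝ 2 (μ : Measure Ω)) :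
    hK.operator μ f =ᵐ[(μ : Measure Ω)] integralOperator K μ f := by
  refine (ContinuousMap.coeFn_toLp (𝕜 := ℝ) (p := 2) (μ : Measure Ω)
    (hK.operatorToC μ f)).trans (Eventually.of_forall fun x => ?_)
  rw [hK.operatorToC_apply, hK.inner_sectionLp x f EventuallyEq.rfl]

theorem IsKernel.inner_operator (hK : IsKernel K) (f g : Lp ℝ 2 (μ : Measure Ω)) :
    inner ℝ (hK.operator μ f) g =
      ∫ x, ∫ y, K x y * f y * g x ∂(μ : Measure Ω) ∂(μ : Measure Ω) := by
  rw [L2.inner_def]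
  refine integral_congr_ae ?_
  filter_upwards [hK.coeFn_operator f] with x hx
  rw [hx, real_inner_comm, integral_mul_const]
  rfl

theorem IsKernel.integrable_mul_mul (hK : IsKernel K) (f g : Lp ℝ 2 (μ : Measure Ω)) :
    Integrable (fun p : Ω × Ω => K p.1 p.2 * f p.2 * g p.1)
      ((μ : Measure Ω).prod (μ : Measure Ω)) := by
  obtain ⟨C, hC⟩ := hK.exists_bound
  have h1 : Integrable (fun p : Ω × Ω => g p.1 * f p.2) ((μ : Measure Ω).prod (μ : Measure Ω)) :=
    ((Lp.memLp g).integrable one_le_two).mul_prod ((Lp.memLp f).integrable one_le_two)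
  have h2 := h1.bdd_mul (c := C) hK.continuous.measurable.aestronglyMeasurable
    (Eventually.of_forall fun p => hC p.1 p.2)
  exact h2.congr (Eventually.of_forall fun p => by simp only; ring)

theorem IsKernel.isSymmetric_operator (hK : IsKernel K) :
    (hK.operator μ : Lp ℝ 2 (μ : Measure Ω) →ₗ[ℝ] Lp ℝ 2 (μ : Measure Ω)).IsSymmetric := by
  intro f g
  rw [ContinuousLinearMap.coe_coe, real_inner_comm _ f, hK.inner_operator, hK.inner_operator,
    integral_integral_swap (hK.integrable_mul_mul f g)]
  refine integral_congr_ae (Eventually.of_forall fun y =>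
    integral_congr_ae (Eventually.of_forall fun x => ?_))
  simp only [hK.symm x y]; ring

end KernelEnergy

/-! ### Mercer's theorem -/

namespace KernelEnergy

variable {Ω : Type*} [MetricSpace Ω] [CompactSpace Ω] {K : Ω → Ω → ℝ}
  [MeasurableSpace Ω] [BorelSpace Ω] {μ : ProbabilityMeasure Ω}

/-- Pointwise defined representatives of an orthonormal basis of eigenvectors of the integral
operator, with nonnegative eigenvalues. -/
structure EigenSystem (K : Ω → Ω → ℝ) (μ : ProbabilityMeasure Ω) (ι : Type*) where
  basis : HilbertBasis ι ℝ (Lp ℝ 2 (μ : Measure Ω))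
  lam : ι → ℝ
  φ : ι → Ω → ℝ
  coeFn_basis : ∀ i, basis i =ᵐ[(μ : Measure Ω)] φ i
  integralOperator_eq : ∀ i x, integralOperator K μ (φ i) x = lam i * φ i x
  lam_nonneg : ∀ i, 0 ≤ lam i

namespace EigenSystem

variable {ι : Type*} (S : EigenSystem K μ ι)

theorem inner_sectionLp (hK : IsKernel K) (i : ι) (x : Ω) :
    inner ℝ (hK.sectionLp μ x) (S.basis i) = S.lam i * S.φ i x := by
  rw [hK.inner_sectionLp x _ (S.coeFn_basis i), S.integralOperator_eq]

theorem operatorToC_basis (hK : IsKernel K) (i : ι) (x : Ω) :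
    hK.operatorToC μ (S.basis i) x = S.lam i * S.φ i x :=
  S.inner_sectionLp hK i x

theorem operator_basis (hK : IsKernel K) (i : ι) :
    hK.operator μ (S.basis i) = S.lam i • S.basis i := by
  refine Lp.ext ?_
  filter_upwards [ContinuousMap.coeFn_toLp (𝕜 := ℝ) (p := 2) (μ : Measure Ω)
    (hK.operatorToC μ (S.basis i)), Lp.coeFn_smul (S.lam i) (S.basis i), S.coeFn_basis i]
    with x h1 h2 h3
  rw [h2, Pi.smul_apply, h3, smul_eq_mul, ← S.operatorToC_basis hK]
  exact h1

/-- The factor λ_i matters: when it is zero, φ_i may be any representative, continuous or not. -/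
theorem continuous_lam_mul (hK : IsKernel K) (i : ι) : Continuous fun x => S.lam i * S.φ i x :=
  (hK.operatorToC μ (S.basis i)).continuous.congr fun x => S.operatorToC_basis hK i x

theorem continuous_of_lam_ne_zero (hK : IsKernel K) {i : ι} (hi : S.lam i ≠ 0) :
    Continuous (S.φ i) := by
  have h := (S.continuous_lam_mul hK i).const_mul (S.lam i)⁻¹
  refine h.congr fun x => ?_
  field_simp

theorem continuous_term (hK : IsKernel K) (i : ι) :
    Continuous fun p : Ω × Ω => S.lam i * S.φ i p.1 * S.φ i p.2 := by
  by_cases hi : S.lam i = 0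
  · simp only [hi, zero_mul]; exact continuous_const
  · have := S.continuous_of_lam_ne_zero hK hi
    fun_prop

/-- By Parseval, ⟨u, Tu⟩ = ∑ λ_i ⟨u, e_i⟩² with nonnegative terms. -/
theorem sum_inner_sq_le (hK : IsKernel K) (F : Finset ι) (u : Lp ℝ 2 (μ : Measure Ω)) :
    ∑ i ∈ F, S.lam i * inner ℝ u (S.basis i) ^ 2 ≤ inner ℝ u (hK.operator μ u) := by
  have h := S.basis.hasSum_inner_mul_inner u (hK.operator μ u)
  have he : ∀ i, inner ℝ u (S.basis i) * inner ℝ (S.basis i) (hK.operator μ u) =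
      S.lam i * inner ℝ u (S.basis i) ^ 2 := fun i => by
    have h1 : inner ℝ (hK.operator μ (S.basis i)) u = inner ℝ (S.basis i) (hK.operator μ u) :=
      hK.isSymmetric_operator (S.basis i) u
    rw [← h1, S.operator_basis hK, real_inner_smul_left, real_inner_comm u]
    ring
  simp_rw [he] at h
  exact sum_le_hasSum _ (fun i _ => mul_nonneg (S.lam_nonneg i) (sq_nonneg _)) h

/-- The averages of the truncated kernel over squares are nonnegative. -/
theorem setIntegral_remainder_nonneg (hK : IsKernel K) (F : Finset ι) {U : Set Ω}
    (hU : MeasurableSet U) :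
    0 ≤ ∫ p in U ×ˢ U, (K p.1 p.2 - ∑ i ∈ F, S.lam i * S.φ i p.1 * S.φ i p.2)
      ∂((μ : Measure Ω).prod (μ : Measure Ω)) := by
  have hKi : Integrable (fun p : Ω × Ω => K p.1 p.2) ((μ : Measure Ω).prod (μ : Measure Ω)) :=
    integrable_of_continuous hK.continuous
  have hti : ∀ i, Integrable (fun p : Ω × Ω => S.lam i * S.φ i p.1 * S.φ i p.2)
      ((μ : Measure Ω).prod (μ : Measure Ω)) := fun i =>
    integrable_of_continuous (S.continuous_term hK i)
  rw [integral_sub hKi.integrableOn (integrable_finsetSum _ fun i _ => (hti i).integrableOn),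
    integral_finsetSum _ fun i _ => (hti i).integrableOn, sub_nonneg]
  -- Testing against the indicator of U turns the quadratic form of T into the integral of K over U
  -- × U.
  let u : Lp ℝ 2 (μ : Measure Ω) := indicatorConstLp 2 hU (measure_ne_top _ U) (1 : ℝ)
  have hub : ∀ i, inner ℝ u (S.basis i) = ∫ x in U, S.φ i x ∂(μ : Measure Ω) := fun i => by
    rw [L2.inner_indicatorConstLp_one]
    exact integral_congr_ae (ae_restrict_of_ae (S.coeFn_basis i))
  have huT : inner ℝ u (hK.operator μ u) =
      ∫ p in U ×ˢ U, K p.1 p.2 ∂((μ : Measure Ω).prod (μ : Measure Ω)) := by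
    rw [L2.inner_indicatorConstLp_one, setIntegral_prod _ hKi.integrableOn]
    refine integral_congr_ae (ae_restrict_of_ae ?_)
    filter_upwards [hK.coeFn_operator (μ := μ) u] with x hx
    rw [hx, ← integral_indicator hU]
    refine integral_congr_ae ?_
    filter_upwards [indicatorConstLp_coeFn (p := 2) (hs := hU)
      (hμs := measure_ne_top (μ : Measure Ω) U) (c := (1 : ℝ))] with y hy
    rw [hy]
    by_cases hyU : y ∈ U <;> simp [hyU]
  have h := S.sum_inner_sq_le hK F u
  rw [huT] at h
  refine le_trans (le_of_eq (Finset.sum_congr rfl fun i _ => ?_)) h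
  rw [hub, setIntegral_prod _ (hti i).integrableOn]
  simp only [integral_const_mul, integral_mul_const]
  ring

variable [(μ : Measure Ω).IsOpenPosMeasure]

/-- A remainder negative at (x, x) stays below some δ < 0 on U × U for a neighbourhood U of x. Full
support gives μ(U) > 0, so the integral over U × U would be negative. -/
theorem sum_diag_le (hK : IsKernel K) (F : Finset ι) (x : Ω) :
    ∑ i ∈ F, S.lam i * S.φ i x ^ 2 ≤ K x x := by
  by_contra! hlt
  set R : Ω × Ω → ℝ := fun p => K p.1 p.2 - ∑ i ∈ F, S.lam i * S.φ i p.1 * S.φ i p.2 with hR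
  have hRc : Continuous R :=
    hK.continuous.sub (continuous_finsetSum _ fun i _ => S.continuous_term hK i)
  have hRx : R (x, x) < 0 := by
    simp only [hR, sub_neg]
    refine hlt.trans_eq (Finset.sum_congr rfl fun i _ => ?_)
    ring
  obtain ⟨δ, hδ, hRδ⟩ : ∃ δ < 0, R (x, x) < δ := ⟨R (x, x) / 2, by linarith, by linarith⟩
  have hmem : {p | R p < δ} ∈ 𝓝 (x, x) := (isOpen_lt hRc continuous_const).mem_nhds hRδ
  obtain ⟨U₁, hU₁, U₂, hU₂, hsub⟩ := mem_nhds_prod_iff.1 hmem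
  obtain ⟨U, hUsub, hUo, hxU⟩ := mem_nhds_iff.1 (inter_mem hU₁ hU₂)
  have hpos : 0 < (μ : Measure Ω).real U :=
    ENNReal.toReal_pos (hUo.measure_pos _ ⟨x, hxU⟩).ne' (measure_ne_top _ _)
  have h0 := S.setIntegral_remainder_nonneg hK F hUo.measurableSet
  have hle : ∫ p in U ×ˢ U, R p ∂((μ : Measure Ω).prod (μ : Measure Ω)) ≤
      ∫ p in U ×ˢ U, δ ∂((μ : Measure Ω).prod (μ : Measure Ω)) :=
    setIntegral_mono_on (integrable_of_continuous hRc).integrableOn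
      (integrable_const _).integrableOn (hUo.measurableSet.prod hUo.measurableSet)
      fun p hp => (hsub ⟨(hUsub hp.1).1, (hUsub hp.2).2⟩ : R p < δ).le
  rw [setIntegral_const, measureReal_prod_prod, smul_eq_mul] at hle
  nlinarith [mul_pos hpos hpos]

omit [MetricSpace Ω] [CompactSpace Ω] [BorelSpace Ω] [(μ : Measure Ω).IsOpenPosMeasure] in
theorem sq_sum_le (t : Finset ι) (x y : Ω) :
    (∑ i ∈ t, S.lam i * S.φ i x * S.φ i y) ^ 2 ≤
      (∑ i ∈ t, S.lam i * S.φ i x ^ 2) * ∑ i ∈ t, S.lam i * S.φ i y ^ 2 :=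
  Finset.sum_sq_le_sum_mul_sum_of_sq_le_mul t
    (fun i _ => mul_nonneg (S.lam_nonneg i) (sq_nonneg _))
    (fun i _ => mul_nonneg (S.lam_nonneg i) (sq_nonneg _)) (fun i _ => le_of_eq (by ring))

theorem summable_diag (hK : IsKernel K) (x : Ω) : Summable fun i => S.lam i * S.φ i x ^ 2 :=
  summable_of_sum_le (fun i => mul_nonneg (S.lam_nonneg i) (sq_nonneg _))
    fun F => S.sum_diag_le hK F x

/-- For fixed x, Cauchy–Schwarz and the diagonal bound make the series summable in C(Ω). In L² its
sum is the basis expansion of K(x, ·), and full support makes C(Ω) → L² injective. -/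
theorem hasSum (hK : IsKernel K) (x y : Ω) :
    HasSum (fun i => S.lam i * S.φ i x * S.φ i y) (K x y) := by
  let g : ι → C(Ω, ℝ) := fun i => S.φ i x • hK.operatorToC μ (S.basis i)
  have hg : ∀ i z, g i z = S.lam i * S.φ i x * S.φ i z := fun i z => by
    change S.φ i x * hK.operatorToC μ (S.basis i) z = _
    rw [S.operatorToC_basis hK]; ring
  obtain ⟨C, hC⟩ := hK.exists_bound
  have hC0 : 0 ≤ C := (abs_nonneg _).trans (hC x x)
  have hsum : Summable g := by
    rw [summable_iff_vanishing_norm]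
    intro ε hε
    obtain ⟨s, hs⟩ := summable_iff_vanishing_norm.1 (S.summable_diag hK x)
      -- The tail squared is at most C times the diagonal tail at x; C + 1 avoids dividing by zero.
      (ε ^ 2 / (C + 1)) (by positivity)
    refine ⟨s, fun t ht => (ContinuousMap.norm_lt_iff _ hε).2 fun z => ?_⟩
    have h1 := hs t ht
    have h2 := S.sq_sum_le t x z
    have h3 : ∑ i ∈ t, S.lam i * S.φ i z ^ 2 ≤ C :=
      (S.sum_diag_le hK t z).trans ((le_abs_self _).trans (hC z z))
    have h4 : 0 ≤ ∑ i ∈ t, S.lam i * S.φ i x ^ 2 :=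
      Finset.sum_nonneg fun i _ => mul_nonneg (S.lam_nonneg i) (sq_nonneg _)
    rw [Real.norm_of_nonneg h4, lt_div_iff₀ (by positivity)] at h1
    rw [ContinuousMap.sum_apply, Finset.sum_congr rfl fun i _ => hg i z, Real.norm_eq_abs]
    refine abs_lt_of_sq_lt_sq ?_ hε.le
    nlinarith [mul_le_mul_of_nonneg_left h3 h4]
  have hval : ∑' i, g i = hK.toCurry x := by
    refine ContinuousMap.toLp_injective (p := 2) (𝕜 := ℝ) (μ : Measure Ω) ?_
    have h1 := hsum.hasSum.mapL (ContinuousMap.toLp (E := ℝ) 2 (μ : Measure Ω) ℝ)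
    have h2 := S.basis.hasSum_repr (hK.sectionLp μ x)
    refine h1.unique (h2.congr_fun fun i => ?_)
    rw [map_smul]
    change S.φ i x • hK.operator μ (S.basis i) = _
    rw [S.operator_basis hK, S.basis.repr_apply_apply, real_inner_comm, S.inner_sectionLp hK,
      smul_smul, mul_comm]
  have h := hsum.hasSum
  rw [hval] at h
  exact (h.mapL (ContinuousMap.evalCLM ℝ y)).congr_fun fun i => (hg i y).symm

/-- Cauchy–Schwarz for the tail, which reduces uniform convergence to the diagonal. -/
theorem sq_sub_sum_le (hK : IsKernel K) (F : Finset ι) (x y : Ω) :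
    (K x y - ∑ i ∈ F, S.lam i * S.φ i x * S.φ i y) ^ 2 ≤
      (K x x - ∑ i ∈ F, S.lam i * S.φ i x ^ 2) * (K y y - ∑ i ∈ F, S.lam i * S.φ i y ^ 2) := by
  classical
  have ht : Tendsto (fun G : Finset ι => (∑ i ∈ G, S.lam i * S.φ i x * S.φ i y -
      ∑ i ∈ F, S.lam i * S.φ i x * S.φ i y) ^ 2) atTop
      (𝓝 ((K x y - ∑ i ∈ F, S.lam i * S.φ i x * S.φ i y) ^ 2)) :=
    (Tendsto.sub_const (S.hasSum hK x y) _).pow 2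
  refine le_of_tendsto ht ((eventually_ge_atTop F).mono fun G hG => ?_)
  have hd : ∀ z, ∑ i ∈ G \ F, S.lam i * S.φ i z ^ 2 ≤
      K z z - ∑ i ∈ F, S.lam i * S.φ i z ^ 2 := fun z => by
    rw [Finset.sum_sdiff_eq_sub hG]
    exact sub_le_sub_right (S.sum_diag_le hK G z) _
  rw [← Finset.sum_sdiff_eq_sub hG]
  exact (S.sq_sum_le _ x y).trans (mul_le_mul (hd x) (hd y)
    (Finset.sum_nonneg fun i _ => mul_nonneg (S.lam_nonneg i) (sq_nonneg _))
    (sub_nonneg.2 (S.sum_diag_le hK F x)))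

/-- Dini's theorem: the partial sums are continuous and increasing, with a continuous limit on a
compact space. -/
theorem tendstoUniformly_diag (hK : IsKernel K) :
    TendstoUniformly (fun (F : Finset ι) x => ∑ i ∈ F, S.lam i * S.φ i x ^ 2)
      (fun x => K x x) atTop := by
  refine Monotone.tendstoUniformly_of_forall_tendsto (fun F => ?_) (fun F G hFG x => ?_) ?_
    fun x => ?_
  · refine continuous_finsetSum _ fun i _ => ?_
    refine ((S.continuous_term hK i).comp (by fun_prop : Continuous fun x => (x, x))).congr
      fun x => ?_
    simp only [Function.comp_apply]; ring
  · exact Finset.sum_le_sum_of_subset_of_nonneg hFG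
      fun i _ _ => mul_nonneg (S.lam_nonneg i) (sq_nonneg _)
  · exact hK.continuous.comp (by fun_prop : Continuous fun x => (x, x))
  · exact (S.hasSum hK x x).congr_fun fun i => by ring

/-- **Mercer's theorem**: the eigenfunction expansion of the kernel converges uniformly. -/
theorem tendstoUniformly (hK : IsKernel K) :
    TendstoUniformly (fun (F : Finset ι) (p : Ω × Ω) => ∑ i ∈ F, S.lam i * S.φ i p.1 * S.φ i p.2)
      (fun p => K p.1 p.2) atTop := by
  have h := S.tendstoUniformly_diag hK
  rw [Metric.tendstoUniformly_iff] at h ⊢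
  intro ε hε
  filter_upwards [h ε hε] with F hF p
  have hd : ∀ z, 0 ≤ K z z - ∑ i ∈ F, S.lam i * S.φ i z ^ 2 ∧
      K z z - ∑ i ∈ F, S.lam i * S.φ i z ^ 2 < ε := fun z =>
    ⟨sub_nonneg.2 (S.sum_diag_le hK F z), (le_abs_self _).trans_lt (hF z)⟩
  rw [Real.dist_eq]
  refine abs_lt_of_sq_lt_sq ((S.sq_sub_sum_le hK F p.1 p.2).trans_lt ?_) hε.le
  rw [sq]
  exact mul_lt_mul'' (hd _).2 (hd _).2 (hd _).1 (hd _).1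

theorem summable_abs (hK : IsKernel K) (x y : Ω) :
    Summable fun i => |S.lam i * S.φ i x * S.φ i y| :=
  (S.hasSum hK x y).summable.abs

end EigenSystem

/-- An eigenvector of the integral operator has a representative which satisfies the eigenvalue
equation everywhere. -/
theorem exists_eigenfunction (hK : IsKernel K) [(μ : Measure Ω).IsOpenPosMeasure] {l : ℝ}
    {f : Lp ℝ 2 (μ : Measure Ω)} (hf : hK.operator μ f = l • f) :
    ∃ φ : Ω → ℝ, f =ᵐ[(μ : Measure Ω)] φ ∧ (∀ x, integralOperator K μ φ x = l * φ x) ∧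
      (l ≠ 0 → Continuous φ) := by
  by_cases hl : l = 0
  · refine ⟨f, EventuallyEq.rfl, fun x => ?_, fun h => absurd hl h⟩
    -- Tf is continuous and vanishes in L², hence everywhere by full support.
    have h0 : hK.operatorToC μ f = 0 := by
      refine ContinuousMap.toLp_injective (p := 2) (𝕜 := ℝ) (μ : Measure Ω) ?_
      rw [map_zero]
      exact hf.trans (by rw [hl, zero_smul])
    rw [← hK.inner_sectionLp x f EventuallyEq.rfl, ← hK.operatorToC_apply, h0, hl, zero_mul]
    rfl
  · have hae : f =ᵐ[(μ : Measure Ω)] fun x => l⁻¹ * hK.operatorToC μ f x := by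
      filter_upwards [ContinuousMap.coeFn_toLp (𝕜 := ℝ) (p := 2) (μ : Measure Ω)
        (hK.operatorToC μ f), Lp.coeFn_smul l f] with x h1 h2
      rw [← hf, Pi.smul_apply, smul_eq_mul] at h2
      rw [← h1, eq_inv_mul_iff_mul_eq₀ hl, ← h2]
      rfl
    refine ⟨_, hae, fun x => ?_, fun _ => by fun_prop⟩
    rw [← hK.inner_sectionLp x f hae, ← hK.operatorToC_apply, mul_inv_cancel_left₀ hl]

/-- If the eigenvalues of the integral operator are nonnegative, then there is an eigensystem
indexed by `dimIndex μ`. -/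
theorem exists_eigenSystem (hK : IsKernel K) [(μ : Measure Ω).IsOpenPosMeasure]
    (hnn : ∀ (l : ℝ) (φ : Ω → ℝ), Continuous φ → (∀ x, integralOperator K μ φ x = l * φ x) →
      ∫ x, φ x ^ 2 ∂(μ : Measure Ω) = 1 → 0 ≤ l) :
    Nonempty (EigenSystem K μ (dimIndex μ)) := by
  obtain ⟨ι, b, l, hb⟩ :=
    exists_hilbertBasis_eigenvectors (hK.isCompactOperator_operator (μ := μ)) hK.isSymmetric_operator
  -- Needed for the separability of L², hence for countability of the basis.
  have : Fact ((2 : ENNReal) ≠ ⊤) := ⟨ENNReal.ofNat_ne_top⟩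
  have : Countable ι := countable_of_hilbertBasis b
  obtain ⟨e⟩ := nonempty_equiv_dimIndex b
  obtain ⟨b', hb'⟩ := exists_reindex b e
  choose φ hφ hφe hφc using fun j =>
    exists_eigenfunction hK (f := b' j) (l := l (e j)) (by rw [hb' j, hb])
  refine ⟨⟨b', fun j => l (e j), φ, hφ, hφe, fun j => ?_⟩⟩
  by_cases hl : l (e j) = 0
  · exact hl.ge
  refine hnn _ _ (hφc j hl) (hφe j) ?_
  have h1 : inner ℝ (b' j) (b' j) = (1 : ℝ) := by
    rw [real_inner_self_eq_norm_sq, b'.orthonormal.1 j, one_pow]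
  rw [L2.inner_def] at h1
  rw [← h1]
  refine integral_congr_ae ?_
  filter_upwards [hφ j] with x hx
  rw [hx, sq]
  rfl

/-- Passes from convergence along all finite sets of indices to ordinary partial sums. -/
theorem tendsto_subtype_range_atTop (s : Set ℕ) [DecidablePred (· ∈ s)] :
    Tendsto (fun N => (Finset.range N).subtype (· ∈ s)) atTop atTop :=
  tendsto_atTop_finset_of_monotone
    (fun M N h => Finset.subtype_mono (Finset.range_mono h))
    fun j => ⟨j + 1, by simp⟩

theorem EigenSystem.exists_expansion (hK : IsKernel K) [(μ : Measure Ω).IsOpenPosMeasure]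
    (S : EigenSystem K μ (dimIndex μ)) :
    ∃ (lam : ℕ → ℝ) (φ : ℕ → Ω → ℝ), IsEigenbasis K μ lam φ ∧ HasNonnegExpansion K μ lam φ := by
  classical
  obtain ⟨lam, hlam⟩ : ∃ lam : ℕ → ℝ, ∀ j : dimIndex μ, lam j = S.lam j :=
    ⟨fun n => if h : n ∈ dimIndex μ then S.lam ⟨n, h⟩ else 0, fun j => by simp⟩
  obtain ⟨φ, hφ⟩ : ∃ φ : ℕ → Ω → ℝ, ∀ j : dimIndex μ, φ j = S.φ j :=
    ⟨fun n => if h : n ∈ dimIndex μ then S.φ ⟨n, h⟩ else 0, fun j => by simp⟩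
  refine ⟨lam, φ, ⟨⟨S.basis, fun j => ?_⟩, fun j hj x => ?_⟩, fun j hj => ?_, fun x y => ?_, ?_⟩
  · rw [hφ]; exact S.coeFn_basis j
  · rw [hφ ⟨j, hj⟩, hlam ⟨j, hj⟩]; exact S.integralOperator_eq _ x
  · rw [hlam ⟨j, hj⟩]; exact S.lam_nonneg _
  · simp_rw [hφ, hlam]; exact S.summable_abs hK x y
  · intro u hu
    filter_upwards [(tendsto_subtype_range_atTop (dimIndex μ)).eventually
      (S.tendstoUniformly hK u hu)] with N hN p
    convert hN p using 2
    rw [← Finset.sum_subtype_eq_sum_filter]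
    simp_rw [hφ, hlam]

end KernelEnergy

/-! ### The convolution square root -/

namespace KernelEnergy

variable {Ω : Type*} [MetricSpace Ω] [CompactSpace Ω] {K : Ω → Ω → ℝ}
  [MeasurableSpace Ω] [BorelSpace Ω] {μ : ProbabilityMeasure Ω}

namespace EigenSystem

variable {ι : Type*} (S : EigenSystem K μ ι)

/-- The truncated convolution root `∑ √λᵢ φᵢ(x) φᵢ(y)`. -/
noncomputable def rootSum (F : Finset ι) (x y : Ω) : ℝ :=
  ∑ i ∈ F, √(S.lam i) * S.φ i x * S.φ i y

/-- The section of the truncated convolution root at `x`, in `L²(Ω, μ)`. -/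
noncomputable def rootSumLp (F : Finset ι) (x : Ω) : Lp ℝ 2 (μ : Measure Ω) :=
  ∑ i ∈ F, (√(S.lam i) * S.φ i x) • S.basis i

omit [MetricSpace Ω] [CompactSpace Ω] [BorelSpace Ω] in
theorem rootSum_comm (F : Finset ι) (x y : Ω) : S.rootSum F x y = S.rootSum F y x :=
  Finset.sum_congr rfl fun i _ => by ring

omit [MetricSpace Ω] [CompactSpace Ω] [BorelSpace Ω] in
theorem coeFn_rootSumLp (F : Finset ι) (x : Ω) :
    S.rootSumLp F x =ᵐ[(μ : Measure Ω)] S.rootSum F x := by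
  have h : ∀ i ∈ F, ∀ᵐ y ∂(μ : Measure Ω), ((√(S.lam i) * S.φ i x) • S.basis i :
      Lp ℝ 2 (μ : Measure Ω)) y = √(S.lam i) * S.φ i x * S.φ i y := fun i _ => by
    filter_upwards [Lp.coeFn_smul (√(S.lam i) * S.φ i x) (S.basis i), S.coeFn_basis i]
      with y h1 h2
    rw [h1, Pi.smul_apply, h2, smul_eq_mul]
  filter_upwards [Lp.coeFn_fun_finsetSum F fun i => (√(S.lam i) * S.φ i x) • S.basis i,
    (Filter.eventually_all_finset F).2 h] with y h1 h2
  exact h1.trans (Finset.sum_congr rfl h2)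

theorem continuous_rootSum (hK : IsKernel K) (F : Finset ι) :
    Continuous fun p : Ω × Ω => S.rootSum F p.1 p.2 := by
  refine continuous_finsetSum _ fun i _ => ?_
  by_cases hi : S.lam i = 0
  · simp only [hi, Real.sqrt_zero, zero_mul]; exact continuous_const
  · have := S.continuous_of_lam_ne_zero hK hi
    fun_prop

omit [MetricSpace Ω] [CompactSpace Ω] [BorelSpace Ω] in
theorem inner_rootSumLp (F : Finset ι) (x y : Ω) :
    inner ℝ (S.rootSumLp F x) (S.rootSumLp F y) = ∑ i ∈ F, S.lam i * S.φ i x * S.φ i y := by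
  rw [rootSumLp, rootSumLp, S.basis.orthonormal.inner_sum]
  refine Finset.sum_congr rfl fun i _ => ?_
  have := Real.mul_self_sqrt (S.lam_nonneg i)
  simp only [conj_trivial]
  linear_combination S.φ i x * S.φ i y * this

variable [(μ : Measure Ω).IsOpenPosMeasure]

/-- The squared norm is a block of the diagonal series of K, so sections of the root converge in L²
at a rate uniform in x. -/
theorem norm_rootSumLp_sub_sq_le (hK : IsKernel K) {F G : Finset ι} (hFG : F ⊆ G) (x : Ω) :
    ‖S.rootSumLp G x - S.rootSumLp F x‖ ^ 2 ≤ K x x - ∑ i ∈ F, S.lam i * S.φ i x ^ 2 := by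
  classical
  have h1 : S.rootSumLp G x - S.rootSumLp F x = S.rootSumLp (G \ F) x :=
    (Finset.sum_sdiff_eq_sub hFG).symm
  rw [h1, ← real_inner_self_eq_norm_sq, S.inner_rootSumLp]
  have h2 : ∑ i ∈ G \ F, S.lam i * S.φ i x * S.φ i x =
      ∑ i ∈ G, S.lam i * S.φ i x ^ 2 - ∑ i ∈ F, S.lam i * S.φ i x ^ 2 := by
    rw [← Finset.sum_sdiff_eq_sub hFG]
    exact Finset.sum_congr rfl fun i _ => by ring
  rw [h2]
  exact sub_le_sub_right (S.sum_diag_le hK G x) _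

theorem exists_monotone_approx (hK : IsKernel K) :
    ∃ F : ℕ → Finset ι, Monotone F ∧
      ∀ n x, K x x - ∑ i ∈ F n, S.lam i * S.φ i x ^ 2 ≤ ((1 / 2 : ℝ) ^ n) ^ 2 := by
  classical
  have h := Metric.tendstoUniformly_iff.1 (S.tendstoUniformly_diag hK)
  choose F hF using fun n : ℕ => eventually_atTop.1 (h (((1 / 2 : ℝ) ^ n) ^ 2) (by positivity))
  -- Partial suprema make the sets increasing; enlarging them keeps the bound, which holds
  -- eventually along finite sets.
  refine ⟨partialSups F, (partialSups F).monotone, fun n x => ?_⟩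
  exact (le_abs_self _).trans (hF n _ (le_partialSups F n) x).le

/-- A positive definite kernel has a convolution root. -/
theorem hasConvolutionRoot (S : EigenSystem K μ ι) (hK : IsKernel K) : HasConvolutionRoot K μ := by
  obtain ⟨F, hmono, hF⟩ := S.exists_monotone_approx hK
  -- Defined at every point, with a default value where there is no limit. Symmetry holds there too,
  -- since the sequences at (x, y) and (y, x) coincide.
  let k : Ω → Ω → ℝ := fun x y => limUnder atTop fun n => S.rootSum (F n) x y
  have hsymm : ∀ x y, k x y = k y x := fun x y => by
    simp only [k, S.rootSum_comm _ x y]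
  have hsm : StronglyMeasurable fun p : Ω × Ω => k p.1 p.2 :=
    StronglyMeasurable.limUnder fun n => (S.continuous_rootSum hK (F n)).stronglyMeasurable
  have hnorm : ∀ x N n, N ≤ n →
      ‖S.rootSumLp (F n) x - S.rootSumLp (F N) x‖ ≤ (1 / 2 : ℝ) ^ N := fun x N n hn =>
    abs_le_of_sq_le_sq' ((S.norm_rootSumLp_sub_sq_le hK (hmono hn) x).trans (hF N x))
      (by positivity) |>.2
  -- The triangle inequality gives 2 · 2⁻ᴺ, and the factor 3 makes the bound strict. Its summability
  -- turns L² convergence into almost everywhere convergence for each x.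
  have hB : ∑' n : ℕ, ENNReal.ofReal (3 * (1 / 2 : ℝ) ^ n) ≠ ⊤ :=
    (summable_geometric_two.mul_left 3).tsum_ofReal_ne_top
  have hcau : ∀ x N n m, N ≤ n → N ≤ m →
      eLpNorm (⇑(S.rootSumLp (F n) x) - ⇑(S.rootSumLp (F m) x)) 2 (μ : Measure Ω) <
        ENNReal.ofReal (3 * (1 / 2 : ℝ) ^ N) := fun x N n m hn hm => by
    rw [← eLpNorm_congr_ae (Lp.coeFn_sub _ _), ← Lp.enorm_def, ← ofReal_norm]
    refine (ENNReal.ofReal_lt_ofReal_iff (by positivity)).2 ?_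
    have h1 := norm_sub_le_norm_sub_add_norm_sub (S.rootSumLp (F n) x) (S.rootSumLp (F N) x)
      (S.rootSumLp (F m) x)
    rw [norm_sub_rev (S.rootSumLp (F N) x)] at h1
    have h2 : (0 : ℝ) < (1 / 2) ^ N := by positivity
    linarith [hnorm x N n hn, hnorm x N m hm]
  have hlim : ∀ x, ∀ᵐ y ∂(μ : Measure Ω),
      Tendsto (fun n => S.rootSumLp (F n) x y) atTop (𝓝 (k x y)) := fun x => by
    filter_upwards [Lp.ae_tendsto_of_cauchy_eLpNorm
      (fun n => Lp.aestronglyMeasurable (S.rootSumLp (F n) x)) one_le_two hB (hcau x),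
      ae_all_iff.2 fun n => S.coeFn_rootSumLp (F n) x] with y h1 h2
    simp_rw [h2] at h1 ⊢
    exact tendsto_nhds_limUnder h1
  have htend : ∀ x, Tendsto (fun n => eLpNorm (⇑(S.rootSumLp (F n) x) - k x) 2
      (μ : Measure Ω)) atTop (𝓝 0) := fun x =>
    Lp.cauchy_tendsto_of_tendsto (fun n => Lp.aestronglyMeasurable (S.rootSumLp (F n) x))
      (k x) hB (hcau x) (hlim x)
  have hkLp : ∀ x, MemLp (k x) 2 (μ : Measure Ω) := fun x =>
    Lp.memLp_of_cauchy_tendsto one_le_two (fun n => Lp.memLp (S.rootSumLp (F n) x)) (k x)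
      (hsm.comp_measurable measurable_prodMk_left).aestronglyMeasurable (htend x)
  have hLp : ∀ x, Tendsto (fun n => S.rootSumLp (F n) x) atTop (𝓝 ((hkLp x).toLp (k x))) :=
    fun x => (Lp.tendsto_Lp_iff_tendsto_eLpNorm _ _ _).2 (htend x)
  have hpow : Tendsto (fun n : ℕ => (1 / 2 : ℝ) ^ n) atTop (𝓝 0) :=
    tendsto_pow_atTop_nhds_zero_of_lt_one (by norm_num) (by norm_num)
  have hKlim : ∀ x y, Tendsto (fun n => ∑ i ∈ F n, S.lam i * S.φ i x * S.φ i y) atTop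
      (𝓝 (K x y)) := fun x y => by
    rw [tendsto_iff_dist_tendsto_zero]
    have hpow2 : Tendsto (fun n : ℕ => ((1 / 2 : ℝ) ^ n) ^ 2) atTop (𝓝 0) := by
      simpa only [ne_eq, OfNat.ofNat_ne_zero, not_false_eq_true, zero_pow] using hpow.pow 2
    refine squeeze_zero (fun _ => dist_nonneg) (fun n => ?_) hpow2
    rw [dist_comm, Real.dist_eq]
    refine abs_le_of_sq_le_sq ((S.sq_sub_sum_le hK (F n) x y).trans ?_) (by positivity)
    rw [sq (((1 / 2 : ℝ) ^ n) ^ 2)]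
    exact mul_le_mul (hF n x) (hF n y) (sub_nonneg.2 (S.sum_diag_le hK _ _)) (by positivity)
  have hint : ∀ x y, Integrable (fun z => k x z * k z y) (μ : Measure Ω) := fun x y =>
    ((hkLp x).integrable_mul (hkLp y)).congr (Eventually.of_forall fun z => by
      simp only [Pi.mul_apply, hsymm y z])
  have hKk : ∀ x y, K x y = ∫ z, k x z * k z y ∂(μ : Measure Ω) := fun x y => by
    have h1 := (hLp x).inner (𝕜 := ℝ) (hLp y)
    simp_rw [S.inner_rootSumLp] at h1
    rw [tendsto_nhds_unique (hKlim x y) h1, L2.inner_def]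
    refine integral_congr_ae ?_
    filter_upwards [(hkLp x).coeFn_toLp, (hkLp y).coeFn_toLp] with z h2 h3
    rw [h2, h3, hsymm z y, real_inner_comm]
    rfl
  refine ⟨k, hsymm, ?_, fun x y => ⟨hint x y, hKk x y⟩⟩
  rw [memLp_two_iff_integrable_sq hsm.aestronglyMeasurable]
  have hsm2 : StronglyMeasurable fun p : Ω × Ω => k p.1 p.2 ^ 2 := hsm.pow 2
  refine (integrable_prod_iff hsm2.aestronglyMeasurable).2
    ⟨Eventually.of_forall fun x => (hkLp x).integrable_sq, ?_⟩
  -- Thus the squared L² norm of k on the product is ∫ K(x, x) dμ(x), which is finite.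
  have hd : ∀ x, ∫ y, ‖k x y ^ 2‖ ∂(μ : Measure Ω) = K x x := fun x => by
    rw [hKk]
    refine integral_congr_ae (Eventually.of_forall fun y => ?_)
    simp only [hsymm y x, Real.norm_eq_abs, abs_pow, sq_abs]
    ring
  simp_rw [hd]
  exact integrable_of_continuous (hK.continuous.comp (by fun_prop : Continuous fun x => (x, x)))

end EigenSystem

end KernelEnergy

/-! ### The equivalences -/

theorem theorem4p2 {Ω : Type*} [MetricSpace Ω] [CompactSpace Ω] [MeasurableSpace Ω] [BorelSpace Ω]
    (K : Ω → Ω → ℝ) (hK : KernelEnergy.IsKernel K)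
    (μ : ProbabilityMeasure Ω) (hinv : KernelEnergy.IsInvariant K μ)
    (hsupp : (μ : Measure Ω).support = Set.univ) :
    List.TFAE [
      KernelEnergy.IsPosDef K,
      KernelEnergy.GeometricMeanInequality K,
      KernelEnergy.IsGlobalMinimizer K μ ∧ 0 ≤ KernelEnergy.energy K (KernelEnergy.toSigned μ),
      ConvexOn ℝ Set.univ (KernelEnergy.energy K : SignedMeasure Ω → ℝ),
      (∃ (lam : ℕ → ℝ) (φ : ℕ → Ω → ℝ), KernelEnergy.HasNonnegExpansion K μ lam φ),
      (∃ (lam : ℕ → ℝ) (φ : ℕ → Ω → ℝ), KernelEnergy.IsEigenbasis K μ lam φ ∧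
        KernelEnergy.HasNonnegExpansion K μ lam φ),
      KernelEnergy.HasConvolutionRoot K μ] := by
  have : Nonempty Ω := μ.nonempty
  have : (μ : Measure Ω).IsOpenPosMeasure := ⟨fun U hU ⟨x, hx⟩ =>
    (Measure.mem_support_iff_forall x |>.1 (hsupp ▸ Set.mem_univ x) U (hU.mem_nhds hx)).ne'⟩
  have hsys : KernelEnergy.IsGlobalMinimizer K μ ∧
      0 ≤ KernelEnergy.energy K (KernelEnergy.toSigned μ) →
      Nonempty (KernelEnergy.EigenSystem K μ (KernelEnergy.dimIndex μ)) := fun h =>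
    KernelEnergy.exists_eigenSystem hK fun _ _ hφ heig hnorm =>
      h.1.eigenvalue_nonneg h.2 hinv hK hφ heig hnorm
  tfae_have 1 → 2 := fun h => h.geometricMeanInequality hK
  tfae_have 2 → 3 := fun h => h.isGlobalMinimizer hK hinv
  tfae_have 3 → 6 := fun h => (hsys h).some.exists_expansion hK
  tfae_have 6 → 5 := fun ⟨lam, φ, _, h⟩ => ⟨lam, φ, h⟩
  tfae_have 5 → 1 := fun ⟨_, _, h⟩ =>
    (KernelEnergy.isFinitelyPosDef_of_hasNonnegExpansion h).isPosDef hK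
  tfae_have 3 → 7 := fun h => (hsys h).some.hasConvolutionRoot hK
  tfae_have 7 → 1 := fun h => (KernelEnergy.isFinitelyPosDef_of_hasConvolutionRoot h).isPosDef hK
  tfae_have 1 → 4 := fun h => h.convexOn_energy hK
  tfae_have 4 → 1 := fun h => KernelEnergy.isPosDef_of_convexOn_energy hK h
  tfae_finish
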